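/- Let $M$ be a smooth $m$-dimensional manifold and $\mathbf{T}M=TM\oplus T^*M$, with the neutral metric $g((X,\alpha),(Y,\mu))=\alpha(Y)+\mu(X)$ and the Courant bracket $$[(X,\alpha),(Y,\mu)]=\bigl([X,Y],\;L_X\mu-L_Y\alpha+\tfrac12 d(\alpha(Y)-\mu(X))\bigr).$$ Let $G$ be a generalized Riemannian metric on $M$, i.e. $G(\mathcal{X},\mathcal{Y})=g(\phi\mathcal{X},\mathcal{Y})$ is positive definite for a smooth endomorphism $\phi$ of $\mathbf{T}M$ with $\phi^2=Id$ and $g(\phi\mathcal{X},\phi\mathcal{Y})=g(\mathcal{X},\mathcal{Y})$. Let $\tau$ be a generalized 2-nilpotent structure, i.e. a smooth endomorphism of $\mathbf{T}M$ of constant rank with $\tau^2=0$ and $g(\mathcal{X},\tau\mathcal{Y})+g(\tau\mathcal{X},\mathcal{Y})=0$, and put $E=\mathrm{im}\,\tau$. Assume that $(G,\tau)$ is a generalized metric 2-nilpotent structure, i.e. $G(\tau\mathcal{X},\tau\mathcal{Y})=G(\mathcal{X},\mathcal{Y})$ for all $\mathcal{X},\mathcal{Y}\in\phi(E)$, and that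 $\tau$ is integrable, i.e. $$[\tau\mathcal{X},\tau\mathcal{Y}]-\tau[\mathcal{X},\tau\mathcal{Y}]-\tau[\tau\mathcal{X},\mathcal{Y}]+\tau^2[\mathcal{X},\mathcal{Y}]=0\qquad\forall\,\mathcal{X},\mathcal{Y}\in\Gamma\mathbf{T}M.$$ Let $\lambda=\tau\circ\phi:E\to E$, which is a complex structure on $E$. Call $D:\Gamma E\times\Gamma E\to\Gamma E$ an $E$-connection if it is additive in both arguments and, for all smooth functions $f$, $D_{fa}b=fD_ab$ and $D_a(fb)=fD_ab+(pr_{TM}a)(f)\,b$. Then $(E,G|_E)$ has a unique Levi-Civita $E$-connection $D^E$, i.e. a unique $E$-connection with $$(pr_{TM}a)(G(b,c))=G(D^E_ab,c)+G(b,D^E_ac),\qquad D^E_ab-D^E_ba=[a,b]\qquad\forall\,a,b,c\in\Gamma E.$$ Moreover, $(G,\tau)$ is of Kähler type, i.e. the $E$-Nijenhuis tensor $$[\lambda a,\lambda b]-\lambda[a,\lambda b]-\lambda[\lambda a,b]+\lambda^2[a,b]\qquad(a,b\in\Gamma E)$$ vanishes, if and only if $D^E_a\lambda=0$ for all $a\in\Gamma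 E$, i.e. $D^E_a(\lambda b)=\lambda(D^E_ab)$ for all $a,b\in\Gamma E$. -/

import Mathlib

open scoped Manifold ContDiff

/-! # The big tangent bundle, the Courant bracket and metric 2-nilpotent structures

`M` is a smooth manifold of dimension `m` (without boundary), modelled on `ℝᵐ`. Smooth sections of
vector bundles are Mathlib's `ContMDiffSection`s of order `∞`. -/

noncomputable section

namespace BigTangent

section Bundles

variable (m : ℕ) (M : Type*) [TopologicalSpace M] [ChartedSpace (EuclideanSpace ℝ (Fin m)) M]

/-- The model fibre `ℝᵐ` of `TM`. -/
abbrev Model : Type := EuclideanSpace ℝ (Fin m)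

/-- The model fibre of `T*M`. -/
abbrev CoModel : Type := Model m →L[ℝ] ℝ

/-- The model fibre of `𝐓M = TM ⊕ T*M`. -/
abbrev BigModel : Type := Model m × CoModel m

/-- The cotangent bundle `T*M`: its fibre at `x` is the dual of `T_x M`. -/
abbrev Cotangent (x : M) : Type := TangentSpace (𝓡 m) x →L[ℝ] Bundle.Trivial M ℝ x

/-- The big tangent bundle `𝐓M = TM ⊕ T*M`. -/
abbrev Big (x : M) : Type := TangentSpace (𝓡 m) x × Cotangent m M x

instance instContinuousAddBig (x : M) : ContinuousAdd (Big m M x) :=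
  inferInstanceAs (ContinuousAdd (TangentSpace (𝓡 m) x × Cotangent m M x))

instance instIsTopologicalAddGroupBig (x : M) : IsTopologicalAddGroup (Big m M x) :=
  inferInstanceAs (IsTopologicalAddGroup (TangentSpace (𝓡 m) x × Cotangent m M x))

instance instContinuousSMulBig (x : M) : ContinuousSMul ℝ (Big m M x) :=
  inferInstanceAs (ContinuousSMul ℝ (TangentSpace (𝓡 m) x × Cotangent m M x))

variable [IsManifold (𝓡 m) ∞ M]

/-- Smooth vector fields. -/
abbrev VField := ContMDiffSection (𝓡 m) (Model m) ∞ (TangentSpace (𝓡 m) : M → Type)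

/-- Smooth differential 1-forms. -/
abbrev OneForm := ContMDiffSection (𝓡 m) (CoModel m) ∞ (Cotangent m M)

/-- `Γ(𝐓M)`: smooth sections of the big tangent bundle. -/
abbrev Sec := ContMDiffSection (𝓡 m) (BigModel m) ∞ (Big m M)

/-- `End(𝐓M)`: smooth sections of the bundle of endomorphisms of the big tangent bundle. -/
abbrev EndBig := ContMDiffSection (𝓡 m) (BigModel m →L[ℝ] BigModel m) ∞
  (fun x : M => Big m M x →L[ℝ] Big m M x)

end Bundles

variable {m : ℕ} {M : Type*} [TopologicalSpace M] [ChartedSpace (EuclideanSpace ℝ (Fin m)) M]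

/-- The neutral metric `g((X,α),(Y,μ)) = α(Y) + μ(X)` on the fibre of `𝐓M` at `x`. -/
def g {x : M} (u v : Big m M x) : ℝ := u.2 v.1 + v.2 u.1

variable [IsManifold (𝓡 m) ∞ M]

/-- The component `pr_{TM} 𝒳` of a section `𝒳` of `𝐓M`. -/
def vec (𝒳 : Sec m M) : VField m M where
  toFun x := (𝒳 x).1
  contMDiff_toFun := by
    intro x
    have h := 𝒳.contMDiff x
    rw [Bundle.contMDiffAt_section] at h ⊢
    exact (contDiff_fst (𝕜 := ℝ) (E := Model m) (F := CoModel m)).contMDiff.contMDiffAt.comp x h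

/-- The component `pr_{T*M} 𝒳` of a section `𝒳` of `𝐓M`. -/
def form (𝒳 : Sec m M) : OneForm m M where
  toFun x := (𝒳 x).2
  contMDiff_toFun := by
    intro x
    have h := 𝒳.contMDiff x
    rw [Bundle.contMDiffAt_section] at h ⊢
    exact (contDiff_snd (𝕜 := ℝ) (E := Model m) (F := CoModel m)).contMDiff.contMDiffAt.comp x h

/-- The section `Ψ𝒳` for an endomorphism `Ψ` of `𝐓M` and a section `𝒳`. -/
def app (Ψ : EndBig m M) (𝒳 : Sec m M) : Sec m M where
  toFun x := Ψ x (𝒳 x)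
  contMDiff_toFun := Ψ.contMDiff.clm_bundle_apply 𝒳.contMDiff

/-- `v(f)`, the derivative at `x` of the function `f` along the tangent vector `v`. -/
def dirDeriv (f : M → ℝ) {x : M} (v : TangentSpace (𝓡 m) x) : ℝ := mvfderiv (𝓡 m) f x v

/-- The operator `Z ↦ X(μ(Z)) - μ([X,Z])` at the point `x`. -/
def lieDerivAux (X : VField m M) (μ : OneForm m M) (x : M)
    (Z : ∀ y : M, TangentSpace (𝓡 m) y) : ℝ :=
  dirDeriv (fun y => μ y (Z y)) (X x) - μ x (VectorField.mlieBracket (𝓡 m) X Z x)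

theorem mdifferentiableAt_pair (μ : OneForm m M) {x : M} {Z : ∀ y : M, TangentSpace (𝓡 m) y}
    (hZ : MDifferentiableAt (𝓡 m) ((𝓡 m).prod 𝓘(ℝ, Model m))
      (fun y => Bundle.TotalSpace.mk' (Model m) y (Z y)) x) :
    MDifferentiableAt (𝓡 m) 𝓘(ℝ, ℝ) (fun y => (μ y (Z y) : ℝ)) x := by
  have h := (μ.contMDiff.mdifferentiable (by simp) x).clm_bundle_apply hZ
  rw [mdifferentiableAt_totalSpace] at h
  exact h.2

/-- `Z ↦ X(μ(Z)) - μ([X,Z])` is tensorial in `Z`. -/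
theorem lieDerivAux_tensorial (X : VField m M) (μ : OneForm m M) (x : M) :
    TensorialAt (𝓡 m) (Model m) (lieDerivAux X μ x) x where
  smul {f Z} hf hZ := by
    have h := mvfderiv_smul hf (mdifferentiableAt_pair μ hZ)
    have e : (fun y => (μ y ((f • Z) y) : ℝ)) = f • (fun y => (μ y (Z y) : ℝ)) := by
      funext y
      exact (μ y).map_smul (f y) (Z y)
    simp only [lieDerivAux, dirDeriv]
    rw [VectorField.mlieBracket_smul_right hf hZ]
    erw [e, h]
    simp
    ring
  add {Z Z'} hZ hZ' := by
    have h := mvfderiv_add (mdifferentiableAt_pair μ hZ) (mdifferentiableAt_pair μ hZ')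
    have e : (fun y => (μ y ((Z + Z') y) : ℝ)) =
        (fun y => (μ y (Z y) : ℝ)) + (fun y => (μ y (Z' y) : ℝ)) := by
      funext y
      exact (μ y).map_add (Z y) (Z' y)
    simp only [lieDerivAux, dirDeriv]
    rw [VectorField.mlieBracket_add_right hZ hZ']
    erw [e, h]
    simp
    ring

/-- The Lie derivative `L_X μ` of a 1-form, `(L_X μ)(Z) = X(μ(Z)) - μ([X,Z])`. -/
def lieDeriv (X : VField m M) (μ : OneForm m M) (x : M) : Cotangent m M x :=
  TensorialAt.mkHom (lieDerivAux X μ x) x (lieDerivAux_tensorial X μ x)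

/-- The Courant bracket
`[(X,α),(Y,μ)] = ([X,Y], L_X μ - L_Y α + ½ d(α(Y) - μ(X)))`, as a field of elements of `𝐓M`. -/
def courant (𝒳 𝒴 : Sec m M) (x : M) : Big m M x :=
  (VectorField.mlieBracket (𝓡 m) (vec 𝒳) (vec 𝒴) x,
    lieDeriv (vec 𝒳) (form 𝒴) x - lieDeriv (vec 𝒴) (form 𝒳) x +
      (1 / 2 : ℝ) • mvfderiv (𝓡 m) (fun y => (𝒳 y).2 (𝒴 y).1 - (𝒴 y).2 (𝒳 y).1 : M → ℝ) x)

/-- The Courant-Nijenhuis torsion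
`N_Ψ(𝒳,𝒴) = [Ψ𝒳,Ψ𝒴] - Ψ[𝒳,Ψ𝒴] - Ψ[Ψ𝒳,𝒴] + Ψ²[𝒳,𝒴]` of an endomorphism of `𝐓M`. -/
def courantNijenhuis (Ψ : EndBig m M) (𝒳 𝒴 : Sec m M) (x : M) : Big m M x :=
  courant (app Ψ 𝒳) (app Ψ 𝒴) x - Ψ x (courant 𝒳 (app Ψ 𝒴) x)
    - Ψ x (courant (app Ψ 𝒳) 𝒴 x) + Ψ x (Ψ x (courant 𝒳 𝒴 x))

variable (m M) in
/-- A generalized Riemannian metric, given by the endomorphism `φ` of `𝐓M` with `φ² = Id`,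
`g(φ𝒳,φ𝒴) = g(𝒳,𝒴)` and such that `G(𝒳,𝒴) = g(φ𝒳,𝒴)` is positive definite. -/
structure GenRiemannian where
  φ : EndBig m M
  φ_sq : ∀ x (u : Big m M x), φ x (φ x u) = u
  φ_isometry : ∀ x (u v : Big m M x), g (φ x u) (φ x v) = g u v
  pos_def : ∀ x (u : Big m M x), u ≠ 0 → 0 < g (φ x u) u

/-- The metric `G(𝒳,𝒴) = g(φ𝒳,𝒴)`. -/
def GenRiemannian.G (𝒢 : GenRiemannian m M) {x : M} (u v : Big m M x) : ℝ := g (𝒢.φ x u) v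

variable (m M) in
/-- A generalized 2-nilpotent structure: a `g`-skew-symmetric endomorphism `τ` of `𝐓M` of constant
rank with `τ² = 0`. -/
structure TwoNilpotent where
  τ : EndBig m M
  τ_sq : ∀ x (u : Big m M x), τ x (τ x u) = 0
  τ_skew : ∀ x (u v : Big m M x), g u (τ x v) + g (τ x u) v = 0
  const_rank : ∃ r : ℕ, ∀ x, Module.finrank ℝ (LinearMap.range (τ x).toLinearMap) = r

namespace TwoNilpotent

variable (T : TwoNilpotent m M) (𝒢 : GenRiemannian m M)

/-- The fibre at `x` of the subbundle `E = im τ`. -/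
def E (x : M) : Submodule ℝ (Big m M x) := LinearMap.range (T.τ x).toLinearMap

/-- `ΓE`: the smooth sections of `𝐓M` with values in `E = im τ`. -/
def ΓE : Submodule ℝ (Sec m M) where
  carrier := {s | ∀ x, s x ∈ T.E x}
  add_mem' hs ht x := (T.E x).add_mem (hs x) (ht x)
  zero_mem' x := (T.E x).zero_mem
  smul_mem' c _ hs x := (T.E x).smul_mem c (hs x)

/-- The product `fe` of a smooth function `f` and a section `e` of `E`. -/
def fsmul (f : ContMDiffMap (𝓡 m) 𝓘(ℝ, ℝ) M ℝ ∞) (e : T.ΓE) : T.ΓE :=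
  ⟨⟨fun x => f x • e.1 x, f.contMDiff.smul_section e.1.contMDiff⟩,
    fun x => (T.E x).smul_mem (f x) (e.2 x)⟩

/-- `τ` is integrable: its Courant-Nijenhuis torsion vanishes. -/
def IsIntegrable : Prop := ∀ (𝒳 𝒴 : Sec m M) (x : M), courantNijenhuis T.τ 𝒳 𝒴 x = 0

/-- `(G,τ)` is a generalized metric 2-nilpotent structure: `τ : φ(E) → E` is a `G`-isometry. -/
def IsCompatible : Prop :=
  ∀ x, ∀ u ∈ (T.E x).map (𝒢.φ x).toLinearMap, ∀ v ∈ (T.E x).map (𝒢.φ x).toLinearMap,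
    𝒢.G (T.τ x u) (T.τ x v) = 𝒢.G u v

/-- The morphism `λ = τ ∘ φ` on the sections of `E`. -/
def lamΓ (e : T.ΓE) : T.ΓE :=
  ⟨app T.τ (app 𝒢.φ e.1), fun x => LinearMap.mem_range_self (T.τ x).toLinearMap (𝒢.φ x (e.1 x))⟩

/-- The `E`-Nijenhuis tensor `[λa,λb] - λ[a,λb] - λ[λa,b] + λ²[a,b]` of `λ = τ ∘ φ`, for sections
`a`, `b` of `E`. The bracket of `ΓE` is the Courant bracket; if `τ` is integrable, `ΓE` is closed
under it. -/
def nijenhuis (a b : T.ΓE) (x : M) : Big m M x :=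
  courant (T.lamΓ 𝒢 a).1 (T.lamΓ 𝒢 b).1 x - T.τ x (𝒢.φ x (courant a.1 (T.lamΓ 𝒢 b).1 x))
    - T.τ x (𝒢.φ x (courant (T.lamΓ 𝒢 a).1 b.1 x))
    + T.τ x (𝒢.φ x (T.τ x (𝒢.φ x (courant a.1 b.1 x))))

/-- `(G,τ)` is of Kähler type: the `E`-Nijenhuis tensor of `λ` vanishes. -/
def IsKahlerType : Prop := ∀ (a b : T.ΓE) (x : M), T.nijenhuis 𝒢 a b x = 0

/-- An `E`-connection on `E`; the anchor of `E` is the projection to `TM`. -/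
structure EConnection where
  D : T.ΓE → T.ΓE → T.ΓE
  add_left : ∀ a b e, D (a + b) e = D a e + D b e
  smul_left : ∀ f a e, D (T.fsmul f a) e = T.fsmul f (D a e)
  add_right : ∀ a e e', D a (e + e') = D a e + D a e'
  leibniz : ∀ f a e x,
    (D a (T.fsmul f e)).1 x = f x • (D a e).1 x + dirDeriv f (a.1 x).1 • e.1 x

/-- `D` is a Levi-Civita `E`-connection of `(E, G|_E)`: it is metric and torsion-free. -/
structure EConnection.IsLeviCivita {T : TwoNilpotent m M} (D : T.EConnection)
    (𝒢 : GenRiemannian m M) : Prop where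
  metric : ∀ (a b c : T.ΓE) (x : M),
    dirDeriv (fun y => 𝒢.G (b.1 y) (c.1 y)) (a.1 x).1 =
      𝒢.G ((D.D a b).1 x) (c.1 x) + 𝒢.G (b.1 x) ((D.D a c).1 x)
  torsion_free : ∀ (a b : T.ΓE) (x : M),
    (D.D a b).1 x - (D.D b a).1 x = courant a.1 b.1 x

/-- `(D_a λ)(b) = D_a(λb) - λ(D_a b)` for an `E`-connection `D`. -/
def covLam (D : T.EConnection) (a b : T.ΓE) : T.ΓE :=
  D.D a (T.lamΓ 𝒢 b) - T.lamΓ 𝒢 (D.D a b)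

end TwoNilpotent

end BigTangent

end

noncomputable section

namespace BigTangent

variable {m : ℕ} {M : Type*} [TopologicalSpace M] [ChartedSpace (EuclideanSpace ℝ (Fin m)) M]

/-! `E = im τ` is `g`-isotropic because `τ` is skew with square zero, so on `ΓE` the Courant bracket
obeys the Leibniz rule of a Lie algebroid. Compatibility makes `λ = τφ` a `G`-skew complex structure
on `E`. Each `a` in `ΓE` is `τ(-φλa)`; inserting such lifts in the integrability condition shows
that `ΓE` is closed under the bracket, and pairing the same identity with a third lift shows that
`ω(a,b) = G(λa,b)` is closed (`IsCompatible.closed`).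

The connection is given explicitly: `2 D_a b` is the `E`-projection of `[a,b] + φ[a,φb] + φ[b,φa]`.
By invariance of `g` under the bracket (`dirDeriv_g`), pairing this with `c` yields the Koszul
formula, and smoothness is inherited from the bracket. Uniqueness is the usual symmetric-skew
argument.

For the Kähler criterion put `S(a,b,c) = G((D_a λ)b,c)`. It is skew in `b, c`, satisfies `S(a,λb,c)
= S(a,b,λc)`, and has zero cyclic sum because `dω = 0`. The Nijenhuis tensor is an expression in
`Dλ`; its vanishing then forces `S = 0` by algebra alone (`eq_zero_of_kaehler_identities`). -/

theorem dirDeriv_add {x : M} {f h : M → ℝ} (hf : MDifferentiableAt (𝓡 m) 𝓘(ℝ, ℝ) f x)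
    (hh : MDifferentiableAt (𝓡 m) 𝓘(ℝ, ℝ) h x) (v : TangentSpace (𝓡 m) x) :
    dirDeriv (fun y => f y + h y) v = dirDeriv f v + dirDeriv h v := by
  have := mvfderiv_add hf hh
  exact congrArg (fun A => A v) this

theorem dirDeriv_sub {x : M} {f h : M → ℝ} (hf : MDifferentiableAt (𝓡 m) 𝓘(ℝ, ℝ) f x)
    (hh : MDifferentiableAt (𝓡 m) 𝓘(ℝ, ℝ) h x) (v : TangentSpace (𝓡 m) x) :
    dirDeriv (fun y => f y - h y) v = dirDeriv f v - dirDeriv h v := by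
  have := mvfderiv_sub hf hh
  exact congrArg (fun A => A v) this

theorem dirDeriv_neg {x : M} {f : M → ℝ} (v : TangentSpace (𝓡 m) x) :
    dirDeriv (fun y => -f y) v = -dirDeriv f v := by
  have := mvfderiv_neg (I := 𝓡 m) (g := f) (x := x)
  exact congrArg (fun A => A v) this

theorem dirDeriv_mul {x : M} {f h : M → ℝ} (hf : MDifferentiableAt (𝓡 m) 𝓘(ℝ, ℝ) f x)
    (hh : MDifferentiableAt (𝓡 m) 𝓘(ℝ, ℝ) h x) (v : TangentSpace (𝓡 m) x) :
    dirDeriv (fun y => f y * h y) v = f x * dirDeriv h v + h x * dirDeriv f v := by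
  have := congrArg (fun A => A v) (mvfderiv_mul hf hh)
  exact this

theorem dirDeriv_zero {x : M} (v : TangentSpace (𝓡 m) x) : dirDeriv (fun _ : M => (0 : ℝ)) v = 0 := by
  have := congrArg (fun A => A v) (mvfderiv_const (I := 𝓡 m) (0 : ℝ) (x := x))
  exact this

theorem dirDeriv_vec_add {x : M} (f : M → ℝ) (v w : TangentSpace (𝓡 m) x) :
    dirDeriv f (v + w) = dirDeriv f v + dirDeriv f w := map_add _ _ _

theorem dirDeriv_vec_smul {x : M} (f : M → ℝ) (c : ℝ) (v : TangentSpace (𝓡 m) x) :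
    dirDeriv f (c • v) = c * dirDeriv f v := map_smul _ _ _

/-- The differential `df` of a function, as an element of the big tangent bundle. -/
def dBig (f : M → ℝ) (x : M) : Big m M x := (0, (mvfderiv (𝓡 m) f x : Cotangent m M x))

theorem g_add_left {x : M} (u v w : Big m M x) : g (u + v) w = g u w + g v w := by
  simp [g]; ring

theorem g_smul_left {x : M} (c : ℝ) (u v : Big m M x) : g (c • u) v = c * g u v := by
  simp [g]; ring

theorem g_comm {x : M} (u v : Big m M x) : g u v = g v u := add_comm _ _

theorem g_neg_left {x : M} (u v : Big m M x) : g (-u) v = -g u v := by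
  simp [g]; ring

theorem g_sub_left {x : M} (u v w : Big m M x) : g (u - v) w = g u w - g v w := by
  rw [sub_eq_add_neg, g_add_left, g_neg_left, sub_eq_add_neg]

variable [IsManifold (𝓡 m) ∞ M]

/-! ### Smoothness of the Courant bracket -/

theorem contMDiffAt_mlieBracket {X Y : ∀ x : M, TangentSpace (𝓡 m) x} {x₀ : M}
    (hX : ContMDiffAt (𝓡 m) ((𝓡 m).prod 𝓘(ℝ, Model m)) ∞
        (fun x => Bundle.TotalSpace.mk' (Model m) x (X x)) x₀)
    (hY : ContMDiffAt (𝓡 m) ((𝓡 m).prod 𝓘(ℝ, Model m)) ∞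
        (fun x => Bundle.TotalSpace.mk' (Model m) x (Y x)) x₀) :
    ContMDiffAt (𝓡 m) ((𝓡 m).prod 𝓘(ℝ, Model m)) ∞
      (fun x => Bundle.TotalSpace.mk' (Model m) x (VectorField.mlieBracket (𝓡 m) X Y x)) x₀ := by
  have : IsManifold (𝓡 m) (minSmoothness ℝ 2) M :=
    IsManifold.of_le (n := ∞) (by
      rw [minSmoothness_of_isRCLikeNormedField]
      exact WithTop.coe_le_coe.2 (le_top (a := (2 : ℕ∞))))
  have : IsManifold (𝓡 m) (((⊤ : ℕ∞) : WithTop ℕ∞) + 1) M := IsManifold.of_le (n := ∞) (by simp)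
  exact ContMDiffAt.mlieBracket_vectorField (m := ⊤) (n := ⊤) hX hY (by simp)

/-- A field of covectors is smooth if it maps smooth local vector fields to smooth functions. -/
theorem contMDiffAt_cotangent_of_apply {η : ∀ x : M, Cotangent m M x} {x₀ : M}
    (h : ∀ Z : ∀ x : M, TangentSpace (𝓡 m) x,
      ContMDiffAt (𝓡 m) ((𝓡 m).prod 𝓘(ℝ, Model m)) ∞
        (fun x => Bundle.TotalSpace.mk' (Model m) x (Z x)) x₀ →
      ContMDiffAt (𝓡 m) 𝓘(ℝ, ℝ) ∞ (fun x => (η x (Z x) : ℝ)) x₀) :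
    ContMDiffAt (𝓡 m) ((𝓡 m).prod 𝓘(ℝ, CoModel m)) ∞
      (fun x => Bundle.TotalSpace.mk' (CoModel m) x (η x)) x₀ := by
  rw [contMDiffAt_hom_bundle]
  refine ⟨contMDiffAt_id, ?_⟩
  let b := EuclideanSpace.basisFun (Fin m) ℝ
  let e := trivializationAt (Model m) (TangentSpace (𝓡 m) : M → Type) x₀
  -- In the trivialization at `x₀`, the coefficients of `η` are its values on the local frame
  -- obtained from the standard basis.
  have key : ∀ x, ContinuousLinearMap.inCoordinates (Model m) (TangentSpace (𝓡 m) : M → Type)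
      ℝ (Bundle.Trivial M ℝ) x₀ x x₀ x (η x) =
      ∑ i, (η x (e.symmL ℝ x (b i)) : ℝ) • (EuclideanSpace.proj i : Model m →L[ℝ] ℝ) := by
    intro x
    ext v
    have hv : v = ∑ i, v i • b i := by
      simpa [b] using (b.sum_repr v).symm
    have h1 : ContinuousLinearMap.inCoordinates (Model m) (TangentSpace (𝓡 m) : M → Type)
      ℝ (Bundle.Trivial M ℝ) x₀ x x₀ x (η x) v = η x (e.symmL ℝ x v) := by
      simp [ContinuousLinearMap.inCoordinates, e]
    rw [h1]
    conv_lhs => rw [hv]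
    rw [map_sum, map_sum]
    simp [mul_comm]
  simp only [key]
  refine ContMDiffAt.sum fun i _ => ?_
  refine (h _ ?_).smul contMDiffAt_const
  have hb : ContMDiffAt (𝓡 m) ((𝓡 m).prod 𝓘(ℝ, Model m)) ∞
      (fun x => Bundle.TotalSpace.mk' (Model m) (E := Bundle.Trivial M (Model m)) x (b i)) x₀ := by
    rw [Bundle.contMDiffAt_section]
    exact contMDiffAt_const
  exact (e.contMDiffAt_symmL (n := ∞) (IB := 𝓡 m)
    (FiberBundle.mem_baseSet_trivializationAt' x₀)).clm_bundle_apply hb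

theorem contMDiffAt_mvfderiv {f : M → ℝ} {x₀ : M} (hf : ContMDiffAt (𝓡 m) 𝓘(ℝ, ℝ) ∞ f x₀) :
    ContMDiffAt (𝓡 m) ((𝓡 m).prod 𝓘(ℝ, CoModel m)) ∞
      (fun x => Bundle.TotalSpace.mk' (CoModel m) x
        (mvfderiv (𝓡 m) f x : Cotangent m M x)) x₀ := by
  rw [contMDiffAt_hom_bundle]
  refine ⟨contMDiffAt_id, ?_⟩
  have h := hf.mfderiv_const (m := ∞) (by simp)
  convert h using 1
  funext x
  ext v
  simp [inTangentCoordinates, ContinuousLinearMap.inCoordinates, mvfderiv]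
  rfl

theorem contMDiffAt_cotangent_apply {η : ∀ x : M, Cotangent m M x}
    {Z : ∀ x : M, TangentSpace (𝓡 m) x} {x₀ : M}
    (hη : ContMDiffAt (𝓡 m) ((𝓡 m).prod 𝓘(ℝ, CoModel m)) ∞
      (fun x => Bundle.TotalSpace.mk' (CoModel m) x (η x)) x₀)
    (hZ : ContMDiffAt (𝓡 m) ((𝓡 m).prod 𝓘(ℝ, Model m)) ∞
        (fun x => Bundle.TotalSpace.mk' (Model m) x (Z x)) x₀) :
    ContMDiffAt (𝓡 m) 𝓘(ℝ, ℝ) ∞ (fun x => (η x (Z x) : ℝ)) x₀ := by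
  have h := hη.clm_bundle_apply hZ
  rw [Bundle.contMDiffAt_section] at h
  exact h

theorem lieDeriv_apply (X : VField m M) (μ : OneForm m M) {x : M}
    {Z : ∀ y : M, TangentSpace (𝓡 m) y}
    (hZ : MDifferentiableAt (𝓡 m) ((𝓡 m).prod 𝓘(ℝ, Model m))
      (fun y => Bundle.TotalSpace.mk' (Model m) y (Z y)) x) :
    (lieDeriv X μ x (Z x) : ℝ) = dirDeriv (fun y => μ y (Z y)) (X x)
      - μ x (VectorField.mlieBracket (𝓡 m) X Z x) :=
  TensorialAt.mkHom_apply (lieDerivAux_tensorial X μ x) hZ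

theorem contMDiffAt_lieDeriv (X : VField m M) (μ : OneForm m M) (x₀ : M) :
    ContMDiffAt (𝓡 m) ((𝓡 m).prod 𝓘(ℝ, CoModel m)) ∞
      (fun x => Bundle.TotalSpace.mk' (CoModel m) x (lieDeriv X μ x)) x₀ := by
  refine contMDiffAt_cotangent_of_apply fun Z hZ => ?_
  have h1 := contMDiffAt_cotangent_apply
    (contMDiffAt_mvfderiv (contMDiffAt_cotangent_apply (μ.contMDiff x₀) hZ)) (X.contMDiff x₀)
  have h2 := contMDiffAt_cotangent_apply (μ.contMDiff x₀)
    (contMDiffAt_mlieBracket (X.contMDiff x₀) hZ)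
  refine (h1.sub h2).congr_of_eventuallyEq ?_
  have : IsManifold (𝓡 m) 1 M := IsManifold.of_le (n := ∞) (by simp)
  -- Order 1 is chosen because regularity at a point spreads to a neighbourhood for finite order,
  -- but not for `∞`.
  filter_upwards [(contMDiffAt_iff_contMDiffAt_nhds (n := 1) (by simp)).1
    (ContMDiffAt.of_le hZ (by simp))] with x hx
  exact lieDeriv_apply X μ (hx.mdifferentiableAt (by simp))

/-- A field of elements of the big tangent bundle with smooth components is smooth. -/
theorem contMDiffAt_big {X : ∀ x : M, TangentSpace (𝓡 m) x} {η : ∀ x : M, Cotangent m M x} {x₀ : M}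
    (hX : ContMDiffAt (𝓡 m) ((𝓡 m).prod 𝓘(ℝ, Model m)) ∞
        (fun x => Bundle.TotalSpace.mk' (Model m) x (X x)) x₀)
    (hη : ContMDiffAt (𝓡 m) ((𝓡 m).prod 𝓘(ℝ, CoModel m)) ∞
      (fun x => Bundle.TotalSpace.mk' (CoModel m) x (η x)) x₀) :
    ContMDiffAt (𝓡 m) ((𝓡 m).prod 𝓘(ℝ, BigModel m)) ∞
      (fun x => Bundle.TotalSpace.mk' (BigModel m) x ((X x, η x) : Big m M x)) x₀ := by
  rw [Bundle.contMDiffAt_section] at hX hη ⊢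
  exact hX.prodMk_space hη

theorem contMDiff_pairing (𝒳 𝒴 : Sec m M) :
    ContMDiff (𝓡 m) 𝓘(ℝ, ℝ) ∞ (fun y => ((𝒳 y).2 (𝒴 y).1 : ℝ)) := fun x =>
  contMDiffAt_cotangent_apply ((form 𝒳).contMDiff x) ((vec 𝒴).contMDiff x)

/-- The Courant bracket of two smooth sections, as a smooth section. -/
def bracket (𝒳 𝒴 : Sec m M) : Sec m M where
  toFun := courant 𝒳 𝒴
  contMDiff_toFun x₀ := by
    refine contMDiffAt_big (contMDiffAt_mlieBracket
      ((vec 𝒳).contMDiff x₀) ((vec 𝒴).contMDiff x₀)) ?_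
    have h1 := contMDiffAt_lieDeriv (vec 𝒳) (form 𝒴) x₀
    have h2 := contMDiffAt_lieDeriv (vec 𝒴) (form 𝒳) x₀
    have h3 := contMDiffAt_mvfderiv
      (((contMDiff_pairing 𝒳 𝒴).sub (contMDiff_pairing 𝒴 𝒳)) x₀)
    have h4 := contMDiffAt_const (I := 𝓡 m) (I' := 𝓘(ℝ, ℝ)) (n := ∞) (x := x₀) (c := (1 / 2 : ℝ))
    exact ((h1.sub_section h2).add_section (h4.smul_section h3))
-- Algebraic identities of the Courant bracket
/-- The product of a smooth function and a section of the big tangent bundle. -/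
def secSMul (f : ContMDiffMap (𝓡 m) 𝓘(ℝ, ℝ) M ℝ ∞) (𝒳 : Sec m M) : Sec m M :=
  ⟨fun x => f x • 𝒳 x, f.contMDiff.smul_section 𝒳.contMDiff⟩

theorem mdifferentiableAt_vec (𝒳 : Sec m M) (x : M) :
    MDifferentiableAt (𝓡 m) ((𝓡 m).prod 𝓘(ℝ, Model m))
      (fun y => Bundle.TotalSpace.mk' (Model m) y ((𝒳 y).1)) x :=
  (vec 𝒳).contMDiff.mdifferentiable (by simp) x

theorem mdifferentiableAt_pairing (𝒳 𝒴 : Sec m M) (x : M) :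
    MDifferentiableAt (𝓡 m) 𝓘(ℝ, ℝ) (fun y => ((𝒳 y).2 (𝒴 y).1 : ℝ)) x :=
  (contMDiff_pairing 𝒳 𝒴).mdifferentiable (by simp) x

/-- The value of the 1-form part of a Courant bracket on a vector field. -/
theorem courant_snd_apply (𝒳 𝒴 : Sec m M) {x : M} {Z : ∀ y : M, TangentSpace (𝓡 m) y}
    (hZ : MDifferentiableAt (𝓡 m) ((𝓡 m).prod 𝓘(ℝ, Model m))
      (fun y => Bundle.TotalSpace.mk' (Model m) y (Z y)) x) :
    ((courant 𝒳 𝒴 x).2 (Z x) : ℝ) =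
      dirDeriv (fun y => (𝒴 y).2 (Z y)) (𝒳 x).1
        - (𝒴 x).2 (VectorField.mlieBracket (𝓡 m) (vec 𝒳) Z x)
      - (dirDeriv (fun y => (𝒳 y).2 (Z y)) (𝒴 x).1
        - (𝒳 x).2 (VectorField.mlieBracket (𝓡 m) (vec 𝒴) Z x))
      + (1 / 2) * (dirDeriv (fun y => (𝒳 y).2 (𝒴 y).1) (Z x)
        - dirDeriv (fun y => (𝒴 y).2 (𝒳 y).1) (Z x)) := by
  rw [← dirDeriv_sub (mdifferentiableAt_pairing _ _ _) (mdifferentiableAt_pairing _ _ _)]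
  have h1 := lieDeriv_apply (vec 𝒳) (form 𝒴) hZ
  have h2 := lieDeriv_apply (vec 𝒴) (form 𝒳) hZ
  exact congrArg₂ (· + ·) (congrArg₂ (· - ·) h1 h2) rfl

/-- Every tangent vector extends to a differentiable local field, so identities of 1-form parts may
be tested with `courant_snd_apply`. -/
theorem big_ext {x : M} {u v : Big m M x} (h1 : u.1 = v.1)
    (h2 : ∀ Z : ∀ y : M, TangentSpace (𝓡 m) y,
      MDifferentiableAt (𝓡 m) ((𝓡 m).prod 𝓘(ℝ, Model m))
        (fun y => Bundle.TotalSpace.mk' (Model m) y (Z y)) x →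
      (u.2 (Z x) : ℝ) = v.2 (Z x)) : u = v := by
  refine Prod.ext h1 (ContinuousLinearMap.ext fun w => ?_)
  have := h2 _ (FiberBundle.mdifferentiableAt_extend (𝓡 m) (Model m) w)
  simpa using this

theorem courant_swap (𝒳 𝒴 : Sec m M) (x : M) : courant 𝒴 𝒳 x = -courant 𝒳 𝒴 x := by
  refine big_ext ?_ fun Z hZ => ?_
  · exact VectorField.mlieBracket_swap_apply
  · have := courant_snd_apply 𝒳 𝒴 hZ
    have h' := courant_snd_apply 𝒴 𝒳 hZ
    simp only [Prod.snd_neg, neg_apply]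
    rw [h']
    erw [this]
    ring

theorem mdifferentiableAt_form_apply (𝒳 : Sec m M) {x : M} {Z : ∀ y : M, TangentSpace (𝓡 m) y}
    (hZ : MDifferentiableAt (𝓡 m) ((𝓡 m).prod 𝓘(ℝ, Model m))
      (fun y => Bundle.TotalSpace.mk' (Model m) y (Z y)) x) :
    MDifferentiableAt (𝓡 m) 𝓘(ℝ, ℝ) (fun y => ((𝒳 y).2 (Z y) : ℝ)) x :=
  mdifferentiableAt_pair (form 𝒳) hZ

theorem courant_add_right (𝒳 𝒴 𝒵 : Sec m M) (x : M) :
    courant 𝒳 (𝒴 + 𝒵) x = courant 𝒳 𝒴 x + courant 𝒳 𝒵 x := by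
  refine big_ext ?_ fun Z hZ => ?_
  · exact VectorField.mlieBracket_add_right (mdifferentiableAt_vec 𝒴 x) (mdifferentiableAt_vec 𝒵 x)
  · have h := courant_snd_apply 𝒳 (𝒴 + 𝒵) hZ
    have h1 := courant_snd_apply 𝒳 𝒴 hZ
    have h2 := courant_snd_apply 𝒳 𝒵 hZ
    have e1 := dirDeriv_add (mdifferentiableAt_form_apply 𝒴 hZ)
      (mdifferentiableAt_form_apply 𝒵 hZ) (𝒳 x).1
    have e2 := dirDeriv_add (mdifferentiableAt_pairing 𝒳 𝒴 x)
      (mdifferentiableAt_pairing 𝒳 𝒵 x) (Z x)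
    have e3 := dirDeriv_add (mdifferentiableAt_pairing 𝒴 𝒳 x)
      (mdifferentiableAt_pairing 𝒵 𝒳 x) (Z x)
    have e4 : VectorField.mlieBracket (𝓡 m) (vec (𝒴 + 𝒵)) Z x =
        VectorField.mlieBracket (𝓡 m) (vec 𝒴) Z x + VectorField.mlieBracket (𝓡 m) (vec 𝒵) Z x :=
      VectorField.mlieBracket_add_left (W := Z) (mdifferentiableAt_vec 𝒴 x)
        (mdifferentiableAt_vec 𝒵 x)
    rw [e4] at h
    simp only [ContMDiffSection.coe_add, Pi.add_apply, Prod.snd_add, Prod.fst_add,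
      add_apply, map_add, dirDeriv_vec_add] at h ⊢
    erw [e1] at h
    rw [e2, e3] at h
    linear_combination h - h1 - h2

theorem courant_add_left (𝒳 𝒴 𝒵 : Sec m M) (x : M) :
    courant (𝒳 + 𝒴) 𝒵 x = courant 𝒳 𝒵 x + courant 𝒴 𝒵 x := by
  rw [courant_swap, courant_add_right, courant_swap 𝒳, courant_swap 𝒴]
  abel

/-- The `df` term is the defect from the Leibniz rule; it disappears on isotropic pairs, in
particular on `E`. -/
theorem courant_secSMul_right (f : ContMDiffMap (𝓡 m) 𝓘(ℝ, ℝ) M ℝ ∞) (𝒳 𝒴 : Sec m M) (x : M) :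
    courant 𝒳 (secSMul f 𝒴) x = f x • courant 𝒳 𝒴 x + dirDeriv f (𝒳 x).1 • 𝒴 x
      - (1 / 2 * g (𝒳 x) (𝒴 x)) • dBig f x := by
  have hf : MDifferentiableAt (𝓡 m) 𝓘(ℝ, ℝ) f x := f.contMDiff.mdifferentiable (by simp) x
  refine big_ext ?_ fun Z hZ => ?_
  · have h : VectorField.mlieBracket (𝓡 m) (vec 𝒳) (vec (secSMul f 𝒴)) x =
      dirDeriv f (𝒳 x).1 • (𝒴 x).1 + f x • VectorField.mlieBracket (𝓡 m) (vec 𝒳) (vec 𝒴) x :=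
      VectorField.mlieBracket_smul_right hf (mdifferentiableAt_vec 𝒴 x)
    rw [Prod.fst_sub, Prod.fst_add]
    simp only [Prod.smul_fst, dBig, smul_zero, sub_zero]
    exact h.trans (add_comm _ _)
  · have h := courant_snd_apply 𝒳 (secSMul f 𝒴) hZ
    have h1 := courant_snd_apply 𝒳 𝒴 hZ
    have e1 := dirDeriv_mul hf (mdifferentiableAt_form_apply 𝒴 hZ) (𝒳 x).1
    have e2 := dirDeriv_mul hf (mdifferentiableAt_pairing 𝒳 𝒴 x) (Z x)
    have e3 := dirDeriv_mul hf (mdifferentiableAt_pairing 𝒴 𝒳 x) (Z x)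
    have e4 : VectorField.mlieBracket (𝓡 m) (vec (secSMul f 𝒴)) Z x =
        -dirDeriv f (Z x) • (𝒴 x).1 + f x • VectorField.mlieBracket (𝓡 m) (vec 𝒴) Z x :=
      VectorField.mlieBracket_smul_left (W := Z) hf (mdifferentiableAt_vec 𝒴 x)
    rw [e4] at h
    have e5 : ∀ y, secSMul f 𝒴 y = f y • 𝒴 y := fun _ => rfl
    have e6 : ((dBig f x).2 (Z x) : ℝ) = dirDeriv f (Z x) := rfl
    simp only [e5, Prod.smul_snd, Prod.smul_fst, Prod.snd_sub, Prod.snd_add, sub_apply, smul_apply,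
      add_apply, map_add, map_smul, dirDeriv_vec_smul, smul_eq_mul, e6, g] at h ⊢
    erw [e1] at h
    rw [e2, e3] at h
    linear_combination h - f x * h1

theorem courant_secSMul_left (f : ContMDiffMap (𝓡 m) 𝓘(ℝ, ℝ) M ℝ ∞) (𝒳 𝒴 : Sec m M) (x : M) :
    courant (secSMul f 𝒳) 𝒴 x = f x • courant 𝒳 𝒴 x - dirDeriv f (𝒴 x).1 • 𝒳 x
      + (1 / 2 * g (𝒳 x) (𝒴 x)) • dBig f x := by
  rw [courant_swap, courant_secSMul_right, courant_swap 𝒳, g_comm]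
  module

/-- The invariance of the neutral metric under the Courant bracket. -/
theorem dirDeriv_g (𝒳 𝒴 𝒵 : Sec m M) (x : M) :
    dirDeriv (fun y => g (𝒴 y) (𝒵 y)) (𝒳 x).1 =
      g (courant 𝒳 𝒴 x) (𝒵 x) + g (𝒴 x) (courant 𝒳 𝒵 x)
      + 1 / 2 * dirDeriv (fun y => g (𝒳 y) (𝒴 y)) (𝒵 x).1
      + 1 / 2 * dirDeriv (fun y => g (𝒳 y) (𝒵 y)) (𝒴 x).1 := by
  have h1 := courant_snd_apply 𝒳 𝒴 (mdifferentiableAt_vec 𝒵 x)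
  have h2 := courant_snd_apply 𝒳 𝒵 (mdifferentiableAt_vec 𝒴 x)
  have e : ∀ 𝒜 ℬ 𝒞 : Sec m M, dirDeriv (fun y => g (𝒜 y) (ℬ y)) (𝒞 x).1 =
      dirDeriv (fun y => (𝒜 y).2 (ℬ y).1) (𝒞 x).1 + dirDeriv (fun y => (ℬ y).2 (𝒜 y).1) (𝒞 x).1 :=
    fun 𝒜 ℬ 𝒞 => dirDeriv_add (mdifferentiableAt_pairing 𝒜 ℬ x) (mdifferentiableAt_pairing ℬ 𝒜 x) _
  rw [e, e, e]
  have f1 : (courant 𝒳 𝒴 x).1 = VectorField.mlieBracket (𝓡 m) (vec 𝒳) (vec 𝒴) x := rfl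
  have f2 : (courant 𝒳 𝒵 x).1 = VectorField.mlieBracket (𝓡 m) (vec 𝒳) (vec 𝒵) x := rfl
  have f3 : VectorField.mlieBracket (𝓡 m) (vec 𝒴) (vec 𝒵) x =
    -VectorField.mlieBracket (𝓡 m) (vec 𝒵) (vec 𝒴) x := VectorField.mlieBracket_swap_apply
  have f4 : ∀ 𝒜 : Sec m M, (fun y => (𝒜 y).1) = vec 𝒜 := fun _ => rfl
  simp only [f4] at h1 h2
  rw [f3, map_neg] at h1
  simp only [g, f1, f2]
  linear_combination -h1 - h2

theorem app_apply (Ψ : EndBig m M) (𝒳 : Sec m M) (x : M) : app Ψ 𝒳 x = Ψ x (𝒳 x) := rfl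

theorem app_secSMul (Ψ : EndBig m M) (f : ContMDiffMap (𝓡 m) 𝓘(ℝ, ℝ) M ℝ ∞) (𝒳 : Sec m M) :
    app Ψ (secSMul f 𝒳) = secSMul f (app Ψ 𝒳) := by
  ext1 x
  exact map_smul (Ψ x) _ _

theorem app_add (Ψ : EndBig m M) (𝒳 𝒴 : Sec m M) : app Ψ (𝒳 + 𝒴) = app Ψ 𝒳 + app Ψ 𝒴 := by
  ext1 x
  exact map_add (Ψ x) _ _

/-! ### Fibrewise algebra of `g`, `G`, `τ` and `φ` -/

section Fibre

variable (T : TwoNilpotent m M) (𝒢 : GenRiemannian m M) {x : M}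

theorem GenRiemannian.g_φ_left (u v : Big m M x) : g (𝒢.φ x u) v = g u (𝒢.φ x v) := by
  rw [← 𝒢.φ_isometry x u, 𝒢.φ_sq]

theorem GenRiemannian.G_comm (u v : Big m M x) : 𝒢.G u v = 𝒢.G v u := by
  rw [GenRiemannian.G, GenRiemannian.G, 𝒢.g_φ_left, g_comm]

theorem GenRiemannian.G_sub_left (u v w : Big m M x) : 𝒢.G (u - v) w = 𝒢.G u w - 𝒢.G v w := by
  rw [GenRiemannian.G, map_sub, g_sub_left]; rfl

theorem GenRiemannian.G_add_left (u v w : Big m M x) : 𝒢.G (u + v) w = 𝒢.G u w + 𝒢.G v w := by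
  rw [GenRiemannian.G, map_add, g_add_left]; rfl

theorem GenRiemannian.G_neg_left (u v : Big m M x) : 𝒢.G (-u) v = -𝒢.G u v := by
  rw [GenRiemannian.G, map_neg, g_neg_left]; rfl

theorem GenRiemannian.G_smul_left (c : ℝ) (u v : Big m M x) : 𝒢.G (c • u) v = c * 𝒢.G u v := by
  rw [GenRiemannian.G, map_smul, g_smul_left]; rfl

theorem GenRiemannian.eq_zero_of_G_self {u : Big m M x} (h : 𝒢.G u u = 0) : u = 0 := by
  by_contra hu
  exact (𝒢.pos_def x u hu).ne' h

namespace TwoNilpotent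

theorem g_τ_right (u v : Big m M x) : g u (T.τ x v) = -g (T.τ x u) v := by
  linarith [T.τ_skew x u v]

theorem g_eq_zero {u v : Big m M x} (hu : u ∈ T.E x) (hv : v ∈ T.E x) : g u v = 0 := by
  obtain ⟨u, rfl⟩ := hu
  obtain ⟨v, rfl⟩ := hv
  change g (T.τ x u) (T.τ x v) = 0
  rw [g_τ_right, T.τ_sq]
  simp [g]

theorem τ_eq_zero {u : Big m M x} (hu : u ∈ T.E x) : T.τ x u = 0 := by
  obtain ⟨u, rfl⟩ := hu
  exact T.τ_sq x u

theorem τ_mem (u : Big m M x) : T.τ x u ∈ T.E x := ⟨u, rfl⟩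

/-- `λ = τ ∘ φ` is skew with respect to `G`. -/
theorem G_τφ_left (u : Big m M x) (v : Big m M x) :
    𝒢.G (T.τ x (𝒢.φ x u)) v = -𝒢.G u (T.τ x (𝒢.φ x v)) := by
  simp only [GenRiemannian.G]
  rw [𝒢.g_φ_left, g_τ_right, neg_neg]

variable {T 𝒢}

/-- `λ = τ ∘ φ` is a complex structure on `E`. -/
theorem IsCompatible.τφ_sq (hG : T.IsCompatible 𝒢) {u : Big m M x} (hu : u ∈ T.E x) :
    T.τ x (𝒢.φ x (T.τ x (𝒢.φ x u))) = -u := by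
  -- By skewness of `λ`, `G(λ²u,v) = -G(λu,λv)`, which compatibility and the isometry `φ` turn into
  -- `-G(u,v)`. Since `λ²u + u` lies in `E`, it may itself be taken as `v`.
  have key : ∀ v ∈ T.E x, 𝒢.G (T.τ x (𝒢.φ x (T.τ x (𝒢.φ x u))) + u) v = 0 := by
    intro v hv
    have h := hG x (𝒢.φ x u) ⟨u, hu, rfl⟩ (𝒢.φ x v) ⟨v, hv, rfl⟩
    have h2 : 𝒢.G (𝒢.φ x u) (𝒢.φ x v) = 𝒢.G u v := 𝒢.φ_isometry x _ _
    rw [𝒢.G_add_left, G_τφ_left, h, h2, neg_add_cancel]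
  exact eq_neg_of_add_eq_zero_left
    (𝒢.eq_zero_of_G_self (key _ ((T.E x).add_mem (T.τ_mem _) hu)))

end TwoNilpotent

end Fibre

/-! ### Existence of the Levi-Civita connection -/

namespace TwoNilpotent

variable (T : TwoNilpotent m M) (𝒢 : GenRiemannian m M)

/-- The operator `-(τ ∘ φ)²`, which is the `G`-orthogonal projection onto `E`. -/
def projE (𝒳 : Sec m M) : T.ΓE :=
  ⟨-app T.τ (app 𝒢.φ (app T.τ (app 𝒢.φ 𝒳))), fun x => (T.E x).neg_mem (T.τ_mem _)⟩

/-- The section `[a,b] + φ[a,φb] + φ[b,φa]`, whose projection to `E` is twice the Levi-Civita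
derivative. -/
def koszul (a b : Sec m M) : Sec m M :=
  bracket a b + app 𝒢.φ (bracket a (app 𝒢.φ b)) + app 𝒢.φ (bracket b (app 𝒢.φ a))

/-- The covariant derivative of the Levi-Civita connection. -/
def lcD (a b : T.ΓE) : T.ΓE := (1 / 2 : ℝ) • T.projE 𝒢 (koszul 𝒢 a.1 b.1)

theorem lcD_apply (a b : T.ΓE) (x : M) :
    (T.lcD 𝒢 a b).1 x = (1 / 2 : ℝ) • -T.τ x (𝒢.φ x (T.τ x (𝒢.φ x (courant a.1 b.1 x
      + 𝒢.φ x (courant a.1 (app 𝒢.φ b.1) x) + 𝒢.φ x (courant b.1 (app 𝒢.φ a.1) x))))) := rfl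

variable {T 𝒢}

/-- As `λ` is `G`-skew, `-λ²` is `G`-symmetric; moved to the other side it fixes `v`. -/
theorem IsCompatible.G_projE (hG : T.IsCompatible 𝒢) {x : M} (u : Big m M x) {v : Big m M x}
    (hv : v ∈ T.E x) : 𝒢.G (-T.τ x (𝒢.φ x (T.τ x (𝒢.φ x u)))) v = 𝒢.G u v := by
  rw [𝒢.G_neg_left, G_τφ_left, G_τφ_left, hG.τφ_sq hv, 𝒢.G_comm u, 𝒢.G_neg_left, 𝒢.G_comm]
  ring

theorem IsCompatible.G_lcD (hG : T.IsCompatible 𝒢) (a b c : T.ΓE) (x : M) :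
    𝒢.G ((T.lcD 𝒢 a b).1 x) (c.1 x) = 1 / 2 * (𝒢.G (courant a.1 b.1 x) (c.1 x)
      + g (courant a.1 (app 𝒢.φ b.1) x) (c.1 x) + g (courant b.1 (app 𝒢.φ a.1) x) (c.1 x)) := by
  rw [lcD_apply, 𝒢.G_smul_left, hG.G_projE _ (c.2 x), 𝒢.G_add_left, 𝒢.G_add_left]
  simp only [GenRiemannian.G, 𝒢.φ_sq]

theorem IsCompatible.app_τ (hG : T.IsCompatible 𝒢) (a : T.ΓE) :
    app T.τ (-app 𝒢.φ (app T.τ (app 𝒢.φ a.1))) = a.1 := by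
  ext1 x
  change T.τ x (-𝒢.φ x (T.τ x (𝒢.φ x (a.1 x)))) = a.1 x
  rw [map_neg, hG.τφ_sq (a.2 x), neg_neg]

/-- For lifts of `a` and `b` through `τ`, integrability and `τ² = 0` express `[a,b]` as a sum of
values of `τ`. -/
theorem IsCompatible.courant_mem (hG : T.IsCompatible 𝒢) (hI : T.IsIntegrable) (a b : T.ΓE)
    (x : M) : courant a.1 b.1 x ∈ T.E x := by
  have h := hI (-app 𝒢.φ (app T.τ (app 𝒢.φ a.1))) (-app 𝒢.φ (app T.τ (app 𝒢.φ b.1))) x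
  rw [courantNijenhuis, hG.app_τ, hG.app_τ, T.τ_sq, add_zero, sub_sub, sub_eq_zero] at h
  rw [h]
  exact (T.E x).add_mem (T.τ_mem _) (T.τ_mem _)

theorem fsmul_coe (f : ContMDiffMap (𝓡 m) 𝓘(ℝ, ℝ) M ℝ ∞) (a : T.ΓE) :
    (T.fsmul f a).1 = secSMul f a.1 := rfl

theorem ΓE_ext {a b : T.ΓE} (h : ∀ x, a.1 x = b.1 x) : a = b :=
  Subtype.ext (ContMDiffSection.ext h)

theorem lcD_add_left (a b e : T.ΓE) : T.lcD 𝒢 (a + b) e = T.lcD 𝒢 a e + T.lcD 𝒢 b e := by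
  refine ΓE_ext fun x => ?_
  change _ = (T.lcD 𝒢 a e).1 x + (T.lcD 𝒢 b e).1 x
  simp only [lcD_apply, Submodule.coe_add, app_add, courant_add_left, courant_add_right, map_add]
  module

theorem lcD_add_right (a b e : T.ΓE) : T.lcD 𝒢 a (b + e) = T.lcD 𝒢 a b + T.lcD 𝒢 a e := by
  refine ΓE_ext fun x => ?_
  change _ = (T.lcD 𝒢 a b).1 x + (T.lcD 𝒢 a e).1 x
  simp only [lcD_apply, Submodule.coe_add, app_add, courant_add_left, courant_add_right, map_add]
  module

/-- The term `-e(f)a` from `[fa,e]` cancels against `φ[e,fφa]`, the `df` terms of the two mixed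
brackets cancel by symmetry of `G`, and the remaining multiple of `φa` is killed by the projection
since `τa = 0`. -/
theorem lcD_fsmul_left (f : ContMDiffMap (𝓡 m) 𝓘(ℝ, ℝ) M ℝ ∞) (a e : T.ΓE) :
    T.lcD 𝒢 (T.fsmul f a) e = T.fsmul f (T.lcD 𝒢 a e) := by
  refine ΓE_ext fun x => ?_
  change _ = f x • (T.lcD 𝒢 a e).1 x
  have hs : g (e.1 x) (𝒢.φ x (a.1 x)) = g (a.1 x) (𝒢.φ x (e.1 x)) := by
    rw [← 𝒢.g_φ_left, g_comm]
  simp only [lcD_apply, fsmul_coe, app_secSMul, courant_secSMul_left, courant_secSMul_right,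
    map_add, map_sub, map_smul, T.g_eq_zero (a.2 x) (e.2 x), app_apply, 𝒢.φ_sq,
    T.τ_eq_zero (a.2 x), hs, map_zero]
  module

/-- Both `[a,fe]` and `φ[a,fφe]` contribute `a(f)e`; the factor one half leaves a single copy. -/
theorem IsCompatible.lcD_fsmul_right (hG : T.IsCompatible 𝒢)
    (f : ContMDiffMap (𝓡 m) 𝓘(ℝ, ℝ) M ℝ ∞) (a e : T.ΓE) (x : M) :
    (T.lcD 𝒢 a (T.fsmul f e)).1 x = f x • (T.lcD 𝒢 a e).1 x + dirDeriv f (a.1 x).1 • e.1 x := by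
  have hs : g (e.1 x) (𝒢.φ x (a.1 x)) = g (a.1 x) (𝒢.φ x (e.1 x)) := by
    rw [← 𝒢.g_φ_left, g_comm]
  simp only [lcD_apply, fsmul_coe, app_secSMul, courant_secSMul_left, courant_secSMul_right,
    map_add, map_sub, map_smul, T.g_eq_zero (a.2 x) (e.2 x), app_apply, 𝒢.φ_sq,
    T.τ_eq_zero (e.2 x), hs, map_zero, hG.τφ_sq (e.2 x)]
  module

/-- The Levi-Civita `E`-connection of a generalized metric 2-nilpotent structure. -/
def IsCompatible.leviCivita (hG : T.IsCompatible 𝒢) : T.EConnection where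
  D := T.lcD 𝒢
  add_left := lcD_add_left
  smul_left := lcD_fsmul_left
  add_right := lcD_add_right
  leibniz := hG.lcD_fsmul_right

/-- Invariance of `g` applied to `a`, `φb`, `c`, where `g(a,c)` vanishes by isotropy. Together with
`G_lcD` it gives the Koszul formula. -/
theorem g_courant_φ (a b c : T.ΓE) (x : M) :
    g (courant a.1 (app 𝒢.φ b.1) x) (c.1 x) = dirDeriv (fun y => 𝒢.G (b.1 y) (c.1 y)) (a.1 x).1
      - 𝒢.G (courant a.1 c.1 x) (b.1 x)
      - 1 / 2 * dirDeriv (fun y => 𝒢.G (a.1 y) (b.1 y)) (c.1 x).1 := by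
  have h := dirDeriv_g a.1 (app 𝒢.φ b.1) c.1 x
  have e0 : (fun y => g (a.1 y) (c.1 y)) = fun _ => 0 :=
    funext fun y => T.g_eq_zero (a.2 y) (c.2 y)
  have e1 : (fun y => g (app 𝒢.φ b.1 y) (c.1 y)) = fun y => 𝒢.G (b.1 y) (c.1 y) := rfl
  have e2 : (fun y => g (a.1 y) (app 𝒢.φ b.1 y)) = fun y => 𝒢.G (a.1 y) (b.1 y) :=
    funext fun y => (𝒢.g_φ_left _ _).symm
  have e4 : g (app 𝒢.φ b.1 x) (courant a.1 c.1 x) = 𝒢.G (courant a.1 c.1 x) (b.1 x) :=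
    𝒢.G_comm _ _
  rw [e0, dirDeriv_zero, e1, e2, e4] at h
  linarith

theorem dirDeriv_G_comm (a b : T.ΓE) {x : M} (v : TangentSpace (𝓡 m) x) :
    dirDeriv (fun y => 𝒢.G (a.1 y) (b.1 y)) v = dirDeriv (fun y => 𝒢.G (b.1 y) (a.1 y)) v :=
  congrArg (fun f => dirDeriv f v) (funext fun _ => 𝒢.G_comm _ _)

theorem IsCompatible.lcD_metric (hG : T.IsCompatible 𝒢) (a b c : T.ΓE) (x : M) :
    dirDeriv (fun y => 𝒢.G (b.1 y) (c.1 y)) (a.1 x).1 =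
      𝒢.G ((T.lcD 𝒢 a b).1 x) (c.1 x) + 𝒢.G (b.1 x) ((T.lcD 𝒢 a c).1 x) := by
  have h1 := hG.G_lcD a b c x
  have h2 := hG.G_lcD a c b x
  have e1 := dirDeriv_G_comm (𝒢 := 𝒢) b a (c.1 x).1
  have e2 := dirDeriv_G_comm (𝒢 := 𝒢) c a (b.1 x).1
  have e3 := dirDeriv_G_comm (𝒢 := 𝒢) c b (a.1 x).1
  have e4 : 𝒢.G (courant c.1 b.1 x) (a.1 x) = -𝒢.G (courant b.1 c.1 x) (a.1 x) := by
    rw [courant_swap, 𝒢.G_neg_left]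
  have e5 := 𝒢.G_comm (b.1 x) ((T.lcD 𝒢 a c).1 x)
  rw [g_courant_φ a b c x, g_courant_φ b a c x] at h1
  rw [g_courant_φ a c b x, g_courant_φ c a b x] at h2
  linear_combination -h1 - h2 - e5 + (1 / 2) * e4 + (1 / 4) * e1 + (1 / 4) * e2 - (1 / 2) * e3

theorem IsCompatible.isLeviCivita (hG : T.IsCompatible 𝒢) (hI : T.IsIntegrable) :
    hG.leviCivita.IsLeviCivita 𝒢 where
  metric := hG.lcD_metric
  torsion_free a b x := by
    change (T.lcD 𝒢 a b).1 x - (T.lcD 𝒢 b a).1 x = _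
    rw [lcD_apply, lcD_apply, courant_swap a.1 b.1]
    -- The two `φ` terms are symmetric in `a, b` and cancel; the projection fixes `[a,b]`, which
    -- lies in `E`.
    simp only [map_add, map_neg, hG.τφ_sq (hG.courant_mem hI a b x)]
    module

/-! ### Uniqueness and the algebra of the Kähler identities -/

/-- A trilinear form that is symmetric in its first two arguments and skew-symmetric in its last
two arguments vanishes. -/
theorem eq_zero_of_symm_of_skew {α : Type*} {S : α → α → α → ℝ} (h₁ : ∀ a b c, S a b c = S b a c)
    (h₂ : ∀ a b c, S a b c = -S a c b) (a b c : α) : S a b c = 0 := by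
  -- Alternating the two symmetries gives `S abc = S bac = -S bca = -S cba = S cab = S acb = -S
  -- abc`.
  linarith [h₁ a b c, h₂ b a c, h₁ b c a, h₂ c b a, h₁ c a b, h₂ a c b]

/-- The difference `a - b` is itself an admissible test section, so no vector of `E` has to be
extended to a section. -/
theorem eq_of_G_eq {a b : T.ΓE} (h : ∀ c : T.ΓE, ∀ x, 𝒢.G (a.1 x - b.1 x) (c.1 x) = 0) : a = b :=
  ΓE_ext fun x => sub_eq_zero.1 (𝒢.eq_zero_of_G_self (h (a - b) x))

theorem EConnection.ext_D {D D' : T.EConnection} (h : ∀ a b, D.D a b = D'.D a b) : D = D' := by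
  cases D; cases D'
  congr
  exact funext fun a => funext fun b => h a b

/-- The Levi-Civita `E`-connection is unique. -/
theorem EConnection.IsLeviCivita.unique {D D' : T.EConnection} (h : D.IsLeviCivita 𝒢)
    (h' : D'.IsLeviCivita 𝒢) : D = D' := by
  refine ext_D fun a b => eq_of_G_eq (𝒢 := 𝒢) fun c x => ?_
  refine eq_zero_of_symm_of_skew
    (S := fun a b c : T.ΓE => 𝒢.G ((D.D a b).1 x - (D'.D a b).1 x) (c.1 x)) ?_ ?_ a b c
  · intro a b c
    have e : (D.D a b).1 x - (D'.D a b).1 x = (D.D b a).1 x - (D'.D b a).1 x := by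
      have h1 := h.torsion_free a b x
      rw [← h'.torsion_free a b x] at h1
      rw [sub_eq_sub_iff_sub_eq_sub]
      exact h1
    rw [e]
  · intro a b c
    have h1 := h.metric a b c x
    rw [h'.metric a b c x, 𝒢.G_comm (b.1 x), 𝒢.G_comm (b.1 x)] at h1
    simp only [𝒢.G_sub_left]
    linarith

/-- Put `Q(a,b,c) = S(Ja,b,c) + S(a,Jb,c)`. By `hN` it is symmetric in `a, b`, and it is skew in `b,
c`, so it vanishes. Adding the cyclic identities for `(Ja,b,c)` and `(a,Jb,c)` gives `Q(a,b,c) +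
Q(b,c,a) + 2 S(c,a,Jb) = 0`; finally `J² = -1` removes the `J`. -/
theorem eq_zero_of_kaehler_identities {α : Type*} {J : α → α} {S : α → α → α → ℝ}
    (skew : ∀ a b c, S a b c = -S a c b) (hJ : ∀ a b c, S a (J b) c = S a b (J c))
    (hJJ : ∀ a b c, S a b (J (J c)) = -S a b c)
    (cyc : ∀ a b c, S a b c + S b c a + S c a b = 0)
    (hN : ∀ a b c, S (J a) b c - S (J b) a c + S a b (J c) - S b a (J c) = 0) (a b c : α) :
    S a b c = 0 := by
  have hQ : ∀ a b c, S (J a) b c + S a (J b) c = 0 :=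
    eq_zero_of_symm_of_skew (S := fun a b c => S (J a) b c + S a (J b) c)
      (fun a b c => by linarith [hN a b c, hJ a b c, hJ b a c])
      (fun a b c => by linarith [hJ a b c, skew a b (J c), skew (J a) b c])
  have h : ∀ a b c, S c a (J b) = 0 := fun a b c => by
    linarith [cyc (J a) b c, cyc a (J b) c, hQ a b c, hQ b c a, hJ b c a, hJ c a b]
  linarith [h b (J c) a, hJJ a b c]

/-! ### Closedness of the fundamental form -/

section Symplectic

variable {x : M}

/-- The section `-φλa`, which `τ` maps to `a`. -/
def lift (T : TwoNilpotent m M) (𝒢 : GenRiemannian m M) (a : T.ΓE) : Sec m M :=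
  -app 𝒢.φ (app T.τ (app 𝒢.φ a.1))

theorem g_lift (a : T.ΓE) (v : Big m M x) :
    g (lift T 𝒢 a x) v = -𝒢.G ((T.lamΓ 𝒢 a).1 x) v := g_neg_left _ _

theorem G_lamΓ_left (a b : T.ΓE) :
    𝒢.G ((T.lamΓ 𝒢 a).1 x) (b.1 x) = -𝒢.G (a.1 x) ((T.lamΓ 𝒢 b).1 x) := T.G_τφ_left 𝒢 _ _

theorem g_courant_lift_right (a b c : T.ΓE) (x : M) :
    g (courant a.1 (lift T 𝒢 b) x) (c.1 x) =
      -dirDeriv (fun y => 𝒢.G ((T.lamΓ 𝒢 b).1 y) (c.1 y)) (a.1 x).1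
      + 𝒢.G ((T.lamΓ 𝒢 b).1 x) (courant a.1 c.1 x)
      + 1 / 2 * dirDeriv (fun y => 𝒢.G ((T.lamΓ 𝒢 b).1 y) (a.1 y)) (c.1 x).1 := by
  have h := dirDeriv_g a.1 (lift T 𝒢 b) c.1 x
  have e0 : (fun y => g (a.1 y) (c.1 y)) = fun _ => 0 :=
    funext fun y => T.g_eq_zero (a.2 y) (c.2 y)
  have e1 : (fun y => g (lift T 𝒢 b y) (c.1 y)) = fun y => -𝒢.G ((T.lamΓ 𝒢 b).1 y) (c.1 y) :=
    funext fun y => g_lift b _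
  have e2 : (fun y => g (a.1 y) (lift T 𝒢 b y)) = fun y => -𝒢.G ((T.lamΓ 𝒢 b).1 y) (a.1 y) :=
    funext fun y => (g_comm _ _).trans (g_lift b _)
  rw [e0, dirDeriv_zero, e1, e2, dirDeriv_neg, dirDeriv_neg, g_lift] at h
  linarith

/-- The 2-form `(a, b) ↦ G(λa, b)` on `E` is closed, because `τ` is integrable. -/
theorem IsCompatible.closed (hG : T.IsCompatible 𝒢) (hI : T.IsIntegrable) (a b c : T.ΓE) (x : M) :
    dirDeriv (fun y => 𝒢.G ((T.lamΓ 𝒢 a).1 y) (c.1 y)) (b.1 x).1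
      - dirDeriv (fun y => 𝒢.G ((T.lamΓ 𝒢 b).1 y) (c.1 y)) (a.1 x).1
      - dirDeriv (fun y => 𝒢.G ((T.lamΓ 𝒢 a).1 y) (b.1 y)) (c.1 x).1
      - 𝒢.G ((T.lamΓ 𝒢 a).1 x) (courant b.1 c.1 x) + 𝒢.G ((T.lamΓ 𝒢 b).1 x) (courant a.1 c.1 x)
      - 𝒢.G ((T.lamΓ 𝒢 c).1 x) (courant a.1 b.1 x) = 0 := by
  have hN := hI (lift T 𝒢 a) (lift T 𝒢 b) x
  have ha : ∀ a, app T.τ (lift T 𝒢 a) = a.1 := hG.app_τ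
  -- Pairing the torsion with the lift of `c` trades the outer `τ` for `c`, by skewness.
  have hτ : ∀ w : Big m M x, g (T.τ x w) (lift T 𝒢 c x) = -g w (c.1 x) := by
    intro w
    have h : T.τ x (lift T 𝒢 c x) = c.1 x := congrArg (fun s : Sec m M => s x) (ha c)
    rw [← h, g_τ_right, neg_neg]
  rw [courantNijenhuis, ha, ha, T.τ_sq, add_zero] at hN
  have h0 := congrArg (fun w => g w (lift T 𝒢 c x)) hN
  have hz : g (0 : Big m M x) (lift T 𝒢 c x) = 0 := by simp [g]
  simp only [g_sub_left, hτ, hz] at h0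
  rw [g_comm, g_lift, courant_swap b.1 (lift T 𝒢 a), g_neg_left, g_courant_lift_right a b c,
    g_courant_lift_right b a c] at h0
  have h1 : dirDeriv (fun y => 𝒢.G ((T.lamΓ 𝒢 b).1 y) (a.1 y)) (c.1 x).1 =
      -dirDeriv (fun y => 𝒢.G ((T.lamΓ 𝒢 a).1 y) (b.1 y)) (c.1 x).1 := by
    rw [← dirDeriv_neg]
    refine congrArg (fun f => dirDeriv f (c.1 x).1) (funext fun y => ?_)
    rw [G_lamΓ_left, 𝒢.G_comm]
  linear_combination h0 - (1 / 2) * h1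

end Symplectic

/-! ### The covariant derivative of `λ` and the Nijenhuis tensor -/

section Kaehler

variable {D : T.EConnection} {x : M}

theorem EConnection.D_neg (D : T.EConnection) (a b : T.ΓE) : D.D a (-b) = -D.D a b :=
  map_neg (AddMonoidHom.mk' (D.D a) (D.add_right a)) b

theorem IsCompatible.lamΓ_lamΓ (hG : T.IsCompatible 𝒢) (b : T.ΓE) :
    T.lamΓ 𝒢 (T.lamΓ 𝒢 b) = -b := ΓE_ext fun x => hG.τφ_sq (b.2 x)

theorem covLam_apply (D : T.EConnection) (a b : T.ΓE) (x : M) :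
    (T.covLam 𝒢 D a b).1 x = (D.D a (T.lamΓ 𝒢 b)).1 x - (T.lamΓ 𝒢 (D.D a b)).1 x := rfl

theorem lamΓ_apply (a : T.ΓE) (x : M) :
    (T.lamΓ 𝒢 a).1 x = T.τ x (𝒢.φ x (a.1 x)) := rfl

/-- This is the derivative of `λ² = -1`. -/
theorem IsCompatible.covLam_lamΓ (hG : T.IsCompatible 𝒢) (D : T.EConnection) (a b : T.ΓE) :
    T.covLam 𝒢 D a (T.lamΓ 𝒢 b) = -T.lamΓ 𝒢 (T.covLam 𝒢 D a b) := by
  refine ΓE_ext fun x => ?_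
  change _ = -(T.lamΓ 𝒢 (T.covLam 𝒢 D a b)).1 x
  rw [covLam_apply, hG.lamΓ_lamΓ, D.D_neg, lamΓ_apply (T.covLam 𝒢 D a b), covLam_apply, map_sub,
    map_sub, lamΓ_apply (D.D a b), hG.τφ_sq ((D.D a b).2 x), lamΓ_apply (D.D a (T.lamΓ 𝒢 b))]
  change -(D.D a b).1 x - _ = _
  abel

/-- A metric connection preserves skewness: `D_a λ` is `G`-skew because `λ` is. -/
theorem EConnection.IsLeviCivita.covLam_skew (h : D.IsLeviCivita 𝒢) (a b c : T.ΓE) :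
    𝒢.G ((T.covLam 𝒢 D a b).1 x) (c.1 x) = -𝒢.G ((T.covLam 𝒢 D a c).1 x) (b.1 x) := by
  have h1 := h.metric a (T.lamΓ 𝒢 b) c x
  have h2 := h.metric a (T.lamΓ 𝒢 c) b x
  have e : dirDeriv (fun y => 𝒢.G ((T.lamΓ 𝒢 b).1 y) (c.1 y)) (a.1 x).1 =
      -dirDeriv (fun y => 𝒢.G ((T.lamΓ 𝒢 c).1 y) (b.1 y)) (a.1 x).1 := by
    rw [← dirDeriv_neg]
    refine congrArg (fun f => dirDeriv f (a.1 x).1) (funext fun y => ?_)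
    rw [G_lamΓ_left, 𝒢.G_comm]
  rw [covLam_apply, covLam_apply, 𝒢.G_sub_left, 𝒢.G_sub_left, G_lamΓ_left (D.D a b),
    G_lamΓ_left (D.D a c), 𝒢.G_comm _ ((T.lamΓ 𝒢 c).1 x), 𝒢.G_comm _ ((T.lamΓ 𝒢 b).1 x)]
  linear_combination -h1 - h2 + e

/-- For a metric torsion-free connection the cyclic sum is `dω(a,b,c)`, so `closed` applies. -/
theorem EConnection.IsLeviCivita.covLam_cyclic (h : D.IsLeviCivita 𝒢) (hG : T.IsCompatible 𝒢)
    (hI : T.IsIntegrable) (a b c : T.ΓE) :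
    𝒢.G ((T.covLam 𝒢 D a b).1 x) (c.1 x) + 𝒢.G ((T.covLam 𝒢 D b c).1 x) (a.1 x)
      + 𝒢.G ((T.covLam 𝒢 D c a).1 x) (b.1 x) = 0 := by
  have h0 := hG.closed hI a b c x
  have hr : ∀ u v w : Big m M x, 𝒢.G u (v - w) = 𝒢.G u v - 𝒢.G u w := fun u v w => by
    rw [𝒢.G_comm, 𝒢.G_sub_left, 𝒢.G_comm v, 𝒢.G_comm w]
  rw [h.metric b (T.lamΓ 𝒢 a) c x, h.metric a (T.lamΓ 𝒢 b) c x, h.metric c (T.lamΓ 𝒢 a) b x,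
    ← h.torsion_free b c x, ← h.torsion_free a c x, ← h.torsion_free a b x, hr, hr, hr] at h0
  have hl : ∀ u v : T.ΓE, 𝒢.G ((T.lamΓ 𝒢 u).1 x) (v.1 x) = -𝒢.G ((T.lamΓ 𝒢 v).1 x) (u.1 x) :=
    fun u v => by rw [G_lamΓ_left, 𝒢.G_comm]
  rw [h.covLam_skew b c a]
  simp only [covLam_apply, 𝒢.G_sub_left]
  linear_combination -h0 - hl b (D.D c a) - hl c (D.D a b) + hl c (D.D b a)

/-- Torsion-freeness turns each bracket into a difference of derivatives, and the terms regroup into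
derivatives of `λ`. -/
theorem EConnection.IsLeviCivita.nijenhuis_eq (h : D.IsLeviCivita 𝒢) (a b : T.ΓE) :
    T.nijenhuis 𝒢 a b x = (T.covLam 𝒢 D (T.lamΓ 𝒢 a) b).1 x - (T.covLam 𝒢 D (T.lamΓ 𝒢 b) a).1 x
      - (T.lamΓ 𝒢 (T.covLam 𝒢 D a b)).1 x + (T.lamΓ 𝒢 (T.covLam 𝒢 D b a)).1 x := by
  rw [nijenhuis, ← h.torsion_free, ← h.torsion_free, ← h.torsion_free, ← h.torsion_free]
  simp only [lamΓ_apply, covLam_apply, map_sub]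
  abel

theorem EConnection.IsLeviCivita.isKahlerType_iff (h : D.IsLeviCivita 𝒢) (hG : T.IsCompatible 𝒢)
    (hI : T.IsIntegrable) : T.IsKahlerType 𝒢 ↔ ∀ a b : T.ΓE, T.covLam 𝒢 D a b = 0 := by
  have hz : ∀ x, (0 : T.ΓE).1 x = 0 := fun _ => rfl
  refine ⟨fun hK a b => ΓE_ext fun x => 𝒢.eq_zero_of_G_self ?_, fun hD a b x => ?_⟩
  -- The third argument of `S` is `(D_a λ)b` itself, so `S = 0` gives its norm zero at `x`.
  · refine eq_zero_of_kaehler_identities (J := T.lamΓ 𝒢)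
      (S := fun a b c => 𝒢.G ((T.covLam 𝒢 D a b).1 x) (c.1 x)) h.covLam_skew ?_ ?_
      (h.covLam_cyclic hG hI) ?_ a b (T.covLam 𝒢 D a b)
    · intro a b c
      rw [hG.covLam_lamΓ]
      change 𝒢.G (-(T.lamΓ 𝒢 (T.covLam 𝒢 D a b)).1 x) (c.1 x) = _
      rw [𝒢.G_neg_left, G_lamΓ_left, neg_neg]
    · intro a b c
      rw [hG.lamΓ_lamΓ, 𝒢.G_comm]
      change 𝒢.G (-c.1 x) _ = _
      rw [𝒢.G_neg_left, 𝒢.G_comm]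
    · intro a b c
      have h0 := hK a b x
      rw [h.nijenhuis_eq] at h0
      have h1 := congrArg (fun w => 𝒢.G w (c.1 x)) h0
      have e : 𝒢.G (0 : Big m M x) (c.1 x) = 0 := by simp [GenRiemannian.G, g]
      simp only [𝒢.G_add_left, 𝒢.G_sub_left, e] at h1
      rw [G_lamΓ_left (T.covLam 𝒢 D a b), G_lamΓ_left (T.covLam 𝒢 D b a)] at h1
      linear_combination h1
  · rw [h.nijenhuis_eq]
    simp only [hD, lamΓ_apply, hz, map_zero]
    simp

end Kaehler

end TwoNilpotent

end BigTangent

end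

theorem proposition5p3 {m : ℕ} {M : Type*} [TopologicalSpace M] [T2Space M]
    [ChartedSpace (EuclideanSpace ℝ (Fin m)) M] [IsManifold (𝓡 m) ∞ M]
    (𝒢 : BigTangent.GenRiemannian m M) (T : BigTangent.TwoNilpotent m M)
    (hG : T.IsCompatible 𝒢) (hI : T.IsIntegrable) :
    ∃ D : T.EConnection, D.IsLeviCivita 𝒢 ∧
      (∀ D' : T.EConnection, D'.IsLeviCivita 𝒢 → D' = D) ∧
      (T.IsKahlerType 𝒢 ↔ ∀ a b : T.ΓE, T.covLam 𝒢 D a b = 0) :=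
  ⟨hG.leviCivita, hG.isLeviCivita hI, fun _ h => h.unique (hG.isLeviCivita hI),
    (hG.isLeviCivita hI).isKahlerType_iff hG hI⟩
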